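/- For real $c$ and an integer $k\ge 0$ write $(c)_k=c(c+1)\cdots(c+k-1)$, $(c)_0=1$. For $n\in\mathbb N$ and real $a_1,a_2,b_1,b_2$ let $$p_n(a_1,a_2;b_1,b_2;x)=\sum_{k=0}^n (-n)_k\,(a_1)_k(a_2)_k\,(b_1+k)_{n-k}(b_2+k)_{n-k}\,\frac{x^k}{k!},$$ which equals $(b_1)_n(b_2)_n\;{}_3F_2(-n,a_1,a_2;b_1,b_2;x)$ whenever $b_1,b_2\notin\{0,-1,\dots,-n+1\}$. For $K\subset\mathbb C$ let $\mathbb P_n(K)$ be the set of polynomials of degree $\le n$ all of whose complex zeros lie in $K$ (the zero polynomial is excluded for $K\ne\mathbb C$). Let $\mathbb Z_n=\{0,1,\dots,n-1\}$. Let $n\ge 4$, $k\in\mathbb Z_n$, $t\in\mathbb Z_n\cup(n-2,\infty)$, $a_2<-n+1$, and let $a_1\in\mathbb R\setminus\{0,-1,\dots,-n+1\}$, so that $p_n(a_1,a_2;b_1,b_2;\cdot)$ has degree exactly $n$. (A) If $b_2>0$, then $p_n(a_1,a_2;b_1,b_2;\cdot)\in\mathbb P_n(\mathbb R_{<0})$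 in each of the following cases: (i) $a_1=k+\tfrac12$ and either $b_1=2-b_2>0$ or $b_1=1-b_2>0$; (ii) $a_1=b_1+k-\tfrac12$ and $b_1=(b_2+t+1)/2$; (iii) $a_1=(b_1+1)/2+k$, $b_1=2(b_2-1+t)$, and $b_1>0$; (iv) $a_1=b_1/2+k$, $b_1=2(b_2+t)-1$, and moreover $b_1>0$ or $k=0$. (B) $p_n(a_1,a_2;b_1,b_2;\cdot)\in\mathbb P_n(\mathbb R)$ in each of the following cases: (v) $a_1=b_2-\tfrac12$, $b_1=2b_2-2$, and $b_2\in(0,1)$; (vi) $a_1=b_2-\tfrac12$, $b_1=2b_2-1$, and $b_2\in(-1,0)$; (vii) $a_1=b_2+k-\tfrac12$, $b_1=2b_2-2$, and $b_2\in(\tfrac12,1)$; (viii) $a_1=k+\tfrac12$, $b_1+b_2\in\{1,2\}$, and $b_2\in(-1,0)$. (C) In particular, both polynomials $p_n(\tfrac12,-n\pm\tfrac12;1,1;\cdot)$, that is, up to the factor $(n!)^2$, the polynomials ${}_3F_2(-n,\tfrac12,-n\pm\tfrac12;1,1;x)$, belong to $\mathbb P_n(\mathbb R_{<0})$; the real-rootedness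 of these polynomials was conjectured by Ringeling and Zudilin. -/

import Mathlib

open Polynomial

noncomputable section

/-- The generalized hypergeometric polynomial of type (i+1, j) with upper parameters
-n, a₁, …, aᵢ and lower parameters b₁, …, bⱼ, in standard normalization:
∑ₖ (-n)₍ₖ₎ ∏ₛ (aₛ)₍ₖ₎ ∏ₛ (bₛ + k)₍ₙ₋ₖ₎ xᵏ / k!, where (c)₍ₖ₎ = c (c + 1) ⋯ (c + k - 1).
When no bₛ is one of 0, -1, …, -n+1 this is ∏ₛ (bₛ)₍ₙ₎ times the terminating
hypergeometric series. -/
def hypergeometricPoly (n : ℕ) {i j : ℕ} (a : Fin i → ℝ) (b : Fin j → ℝ) : ℝ[X] :=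
  ∑ k ∈ Finset.range (n + 1),
    C ((ascPochhammer ℝ k).eval (-(n : ℝ)) * (∏ s, (ascPochhammer ℝ k).eval (a s)) *
        (∏ s, (ascPochhammer ℝ (n - k)).eval (b s + k)) / (k.factorial : ℝ)) * X ^ k

/-- Real polynomials of degree at most n all of whose complex zeros lie in K.
The zero polynomial belongs to this set only for K = ℂ. -/
def polysWithZerosIn (n : ℕ) (K : Set ℂ) : Set ℝ[X] :=
  {p | p.natDegree ≤ n ∧ ∀ z : ℂ, aeval z p = 0 → z ∈ K}

/-- The real line, as a subset of ℂ. -/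
def realLine : Set ℂ := Set.range ((↑) : ℝ → ℂ)

/-- The negative real half-line, as a subset of ℂ. -/
def negRealLine : Set ℂ := ((↑) : ℝ → ℂ) '' Set.Iio 0

end

/-! Up to a nonzero constant, the polynomial has coefficients `hyperCoeff n a₁ b₁ b₂ k` times
`(-1)^k (a₂)_k`. For `a₂ < -n+1` the second factor, weighted by binomials, is a reversed Laguerre
polynomial with negative zeros, so Schur–Szegő composition (`RealRootedSeq.mul`) removes `a₂` from
the problem. What remains is a ₂F₂ polynomial.

Its real-rootedness starts from a product of two Bessel-type series ₀F₁(b)·₀F₁(b'). Finite free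
additive convolution (`RealRootedSeq.add`) multiplies exponential generating functions, and Laguerre
polynomials correspond to ₀F₁. By Chu–Vandermonde the product has coefficients `(b+b'+k-1)_k /
((b)_k (b')_k)`. When `b+b' = 2`, `b' = b` or `b' = b-1`, the duplication formula cancels enough
factors to leave a ₂F₂ in the variable 4x.

Further parameters come from operators preserving real zeros: `c + x d/dx` shifts an upper parameter
up or a lower one down by 1, and composition with a Jacobi polynomial lowers a lower parameter by
any real `t > n-2`. Where the coefficients are positive, real zeros are negative.

Both convolution theorems rest on Grace's apolarity theorem for half-planes, proved by induction
through Laguerre's theorem on polar derivatives. -/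

/-- The complex polynomial of degree at most `n` with real coefficients `c 0, …, c n`. -/
noncomputable def seqPoly (n : ℕ) (c : ℕ → ℝ) : ℂ[X] :=
  ∑ k ∈ Finset.range (n + 1), C (c k : ℂ) * X ^ k

/-- A complex polynomial without zeros in the open upper half-plane. -/
def UpperStable (p : ℂ[X]) : Prop := ∀ z : ℂ, 0 < z.im → p.eval z ≠ 0

/-- The polynomial `c 0 + c 1 x + ⋯ + c n xⁿ` is nonzero and has only real zeros. -/
def RealRootedSeq (n : ℕ) (c : ℕ → ℝ) : Prop := UpperStable (seqPoly n c)

theorem seqPoly_coeff (n : ℕ) (c : ℕ → ℝ) (k : ℕ) :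
    (seqPoly n c).coeff k = if k ≤ n then (c k : ℂ) else 0 := by
  simp [seqPoly, coeff_X_pow]

theorem seqPoly_natDegree_le (n : ℕ) (c : ℕ → ℝ) : (seqPoly n c).natDegree ≤ n := by
  rw [natDegree_le_iff_coeff_eq_zero]
  intro k hk
  rw [seqPoly_coeff, if_neg (by omega)]

theorem seqPoly_eval (n : ℕ) (c : ℕ → ℝ) (z : ℂ) :
    (seqPoly n c).eval z = ∑ k ∈ Finset.range (n + 1), (c k : ℂ) * z ^ k := by
  simp [seqPoly, eval_finsetSum]

theorem seqPoly_congr {n : ℕ} {c d : ℕ → ℝ} (h : ∀ k ≤ n, c k = d k) :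
    seqPoly n c = seqPoly n d := by
  refine Finset.sum_congr rfl fun k hk => ?_
  rw [h k (by simpa [Nat.lt_succ_iff] using hk)]

theorem RealRootedSeq.congr {n : ℕ} {c d : ℕ → ℝ} (hc : RealRootedSeq n c)
    (h : ∀ k ≤ n, c k = d k) : RealRootedSeq n d := by
  rw [RealRootedSeq, ← seqPoly_congr h]
  exact hc

theorem seqPoly_eval_conj (n : ℕ) (c : ℕ → ℝ) (z : ℂ) :
    (seqPoly n c).eval (starRingEnd ℂ z) = starRingEnd ℂ ((seqPoly n c).eval z) := by
  simp [seqPoly_eval, map_sum]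

theorem RealRootedSeq.im_eq_zero {n : ℕ} {c : ℕ → ℝ} (hc : RealRootedSeq n c) {z : ℂ}
    (hz : (seqPoly n c).eval z = 0) : z.im = 0 := by
  rcases lt_trichotomy z.im 0 with h | h | h
  · refine absurd ?_ (hc (starRingEnd ℂ z) (by simpa using h))
    rw [seqPoly_eval_conj, hz, map_zero]
  · exact h
  · exact absurd hz (hc z h)

theorem RealRootedSeq.neg_root {n : ℕ} {c : ℕ → ℝ} (hc : RealRootedSeq n c)
    (hpos : ∀ k ≤ n, 0 < c k) {z : ℂ} (hz : (seqPoly n c).eval z = 0) :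
    z.im = 0 ∧ z.re < 0 := by
  have him := hc.im_eq_zero hz
  refine ⟨him, ?_⟩
  by_contra! hre
  have hzr : z = (z.re : ℂ) := Complex.ext rfl (by simpa using him)
  rw [hzr, seqPoly_eval] at hz
  have hz' : ∑ k ∈ Finset.range (n + 1), c k * z.re ^ k = 0 := by exact_mod_cast hz
  have h0 : 0 < ∑ k ∈ Finset.range (n + 1), c k * z.re ^ k := by
    refine Finset.sum_pos' (fun k hk => ?_) ⟨0, by simp, by simpa using hpos 0 (by omega)⟩
    exact mul_nonneg (hpos k (by simpa [Nat.lt_succ_iff] using hk)).le (pow_nonneg hre k)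
  exact h0.ne' hz'

theorem RealRootedSeq.const_mul {n : ℕ} {c : ℕ → ℝ} (hc : RealRootedSeq n c) {r : ℝ}
    (hr : r ≠ 0) : RealRootedSeq n (fun k => r * c k) := by
  intro z hz h
  refine hc z hz ?_
  rw [seqPoly_eval] at h ⊢
  simp only [Complex.ofReal_mul, mul_assoc, ← Finset.mul_sum] at h
  exact (mul_eq_zero.1 h).resolve_left (by exact_mod_cast hr)

theorem RealRootedSeq.scale {n : ℕ} {c : ℕ → ℝ} (hc : RealRootedSeq n c) {r : ℝ}
    (hr : 0 < r) : RealRootedSeq n (fun k => r ^ k * c k) := by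
  intro z hz h
  refine hc (r * z) (by simpa using mul_pos hr hz) ?_
  rw [seqPoly_eval] at h ⊢
  rw [← h]
  refine Finset.sum_congr rfl fun k _ => ?_
  push_cast
  ring

theorem seqPoly_eval_reverse (n : ℕ) (c : ℕ → ℝ) {z : ℂ} (hz : z ≠ 0) :
    (seqPoly n (fun k => c (n - k))).eval z = z ^ n * (seqPoly n c).eval z⁻¹ := by
  rw [seqPoly_eval, seqPoly_eval, ← Finset.sum_range_reflect, Finset.mul_sum]
  refine Finset.sum_congr rfl fun k hk => ?_
  have hk : k ≤ n := by simpa [Nat.lt_succ_iff] using hk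
  have h1 : n + 1 - 1 - k = n - k := by omega
  have h2 : n - (n - k) = k := by omega
  rw [h1, h2, inv_pow, pow_sub₀ z hz hk]
  ring

theorem RealRootedSeq.reverse {n : ℕ} {c : ℕ → ℝ} (hc : RealRootedSeq n c) :
    RealRootedSeq n (fun k => c (n - k)) := by
  intro z hz h
  have hz0 : z ≠ 0 := by rintro rfl; simp at hz
  rw [seqPoly_eval_reverse n c hz0] at h
  have := hc.im_eq_zero ((mul_eq_zero.1 h).resolve_left (pow_ne_zero n hz0))
  rw [Complex.inv_im, div_eq_zero_iff] at this
  rcases this with h | h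
  · linarith
  · exact hz0 (Complex.normSq_eq_zero.1 h)

/-! ### Logarithmic derivatives -/

theorem re_multiset_sum_ge (m : ℝ) (s : Multiset ℂ) (h : ∀ w ∈ s, m ≤ w.re) :
    m * s.card ≤ s.sum.re := by
  induction s using Multiset.induction_on with
  | empty => simp
  | cons a s ih =>
    have h1 := h a (Multiset.mem_cons_self a s)
    have h2 := ih fun w hw => h w (Multiset.mem_cons_of_mem hw)
    simp only [Multiset.card_cons, Multiset.sum_cons, Complex.add_re]
    push_cast
    linarith

theorem mul_derivative_div_eq (p : ℂ[X]) (g x : ℂ) (hx : p.eval x ≠ 0) :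
    g * (p.derivative.eval x / p.eval x) = (p.roots.map fun a => g / (x - a)).sum := by
  rw [(IsAlgClosed.splits p).eval_derivative_div_eval_of_ne_zero hx, ← Multiset.sum_map_mul_left]
  simp [div_eq_mul_inv]

theorem re_mul_logDeriv_ge (p : ℂ[X]) (g x : ℂ) (m : ℝ) (hx : p.eval x ≠ 0)
    (h : ∀ a, p.eval a = 0 → m ≤ (g / (x - a)).re) :
    m * p.natDegree ≤ (g * (p.derivative.eval x / p.eval x)).re := by
  have hp : p ≠ 0 := by rintro rfl; simp at hx
  rw [mul_derivative_div_eq p g x hx, (IsAlgClosed.splits p).natDegree_eq_card_roots]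
  have := re_multiset_sum_ge m (p.roots.map fun a => g / (x - a)) (by
    intro w hw
    obtain ⟨a, ha, rfl⟩ := Multiset.mem_map.1 hw
    exact h a ((mem_roots hp).1 ha))
  simpa using this

theorem re_mul_logDeriv_gt (p : ℂ[X]) (g x : ℂ) (m : ℝ) (hx : p.eval x ≠ 0)
    (hd : p.natDegree ≠ 0)
    (h : ∀ a, p.eval a = 0 → m < (g / (x - a)).re) :
    m * p.natDegree < (g * (p.derivative.eval x / p.eval x)).re := by
  have hp : p ≠ 0 := by rintro rfl; simp at hx
  obtain ⟨m', hm', hlt⟩ : ∃ m', (∀ a, p.eval a = 0 → m' ≤ (g / (x - a)).re) ∧ m < m' := by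
    have hne : (p.roots.toFinset).Nonempty := by
      obtain ⟨a, ha⟩ := Complex.exists_root
        (natDegree_pos_iff_degree_pos.1 (Nat.pos_of_ne_zero hd))
      exact ⟨a, by simpa [hp] using ha⟩
    obtain ⟨b, hb, hmin⟩ := Finset.exists_min_image _ (fun a => (g / (x - a)).re) hne
    refine ⟨(g / (x - b)).re, fun a ha => hmin a (by simpa [hp] using ha), h b ?_⟩
    simpa [hp] using hb
  refine lt_of_lt_of_le ?_ (re_mul_logDeriv_ge p g x m' hx hm')
  have : (0 : ℝ) < p.natDegree := by exact_mod_cast Nat.pos_of_ne_zero hd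
  exact mul_lt_mul_of_pos_right hlt this

/-! ### Polar derivatives and Walsh's coincidence theorem -/

/-- The map `z ↦ (x-y)/(x-z)` sends the lower half-plane into a disc with centre `(x-y)/(x-x̄)`, and
sends `y` to 1, which lies outside that disc. The multiplier `c = i(ȳ-x)` is the conjugate of the
direction from the centre to 1, so `Re(cw) < Re c` separates the disc from 1. -/
theorem polar_kernel_re_pos {x y z : ℂ} (hx : 0 < x.im) (hy : 0 < y.im) (hz : z.im ≤ 0) :
    -(y.im + x.im) <
      (-((⟨y.im + x.im, y.re - x.re⟩ : ℂ) * (x - y)) / (x - z)).re := by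
  have hxz : x - z ≠ 0 := by
    intro h
    have := congrArg Complex.im h
    simp at this
    linarith
  have hN : 0 < Complex.normSq (x - z) := Complex.normSq_pos.2 hxz
  rw [Complex.div_re, ← add_div, lt_div_iff₀ hN]
  simp only [Complex.normSq_apply, Complex.sub_re, Complex.sub_im, Complex.neg_re, Complex.neg_im,
    Complex.mul_re, Complex.mul_im]
  have h1 : 0 < (y.im + x.im) * ((y.im - z.im) * (x.im - z.im)) :=
    mul_pos (by linarith) (mul_pos (by linarith) (by linarith))
  have h2 := mul_nonneg hy.le (sq_nonneg (z.re - x.re))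
  have h3 := mul_nonneg hx.le (sq_nonneg (z.re - y.re))
  have h4 := mul_nonneg (neg_nonneg.2 hz) (sq_nonneg (y.re - x.re))
  nlinarith

/-- Laguerre's theorem: at a zero `x`, the sum of `(x-y)/(x-a)` over the roots `a` would equal
`n+1`. Each term has `Re(c·) < Re c` with `Re c > 0`, and there are at most `n+1` terms. -/
theorem UpperStable.polar {n : ℕ} {p : ℂ[X]} (hp : UpperStable p) (hdeg : p.natDegree ≤ n + 1)
    {y : ℂ} (hy : 0 < y.im) :
    UpperStable (C ((n : ℂ) + 1) * p - X * derivative p + C y * derivative p) := by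
  intro x hx h
  have hpx := hp x hx
  simp only [eval_add, eval_sub, eval_mul, eval_C, eval_X] at h
  have h1 : ((n : ℂ) + 1) = (x - y) * (p.derivative.eval x / p.eval x) := by
    field_simp
    linear_combination h
  by_cases hd : p.natDegree = 0
  · rw [eq_C_of_natDegree_eq_zero hd] at h1
    simp at h1
    exact Nat.cast_add_one_ne_zero n h1
  · have h2 := re_mul_logDeriv_gt p
      (-((⟨y.im + x.im, y.re - x.re⟩ : ℂ) * (x - y))) x _ hpx hd (fun a ha =>
        polar_kernel_re_pos (z := a) hx hy (by
          by_contra! hlt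
          exact hp a hlt ha))
    rw [show ∀ c u : ℂ, -(c * (x - y)) * u = -(c * ((x - y) * u)) from fun c u => by ring,
      ← h1] at h2
    simp at h2
    have h3 : (p.natDegree : ℝ) ≤ n + 1 := by exact_mod_cast hdeg
    nlinarith

/-- The apolar pairing of two polynomials of degree at most `n`. -/
noncomputable def apolarSum (n : ℕ) (p F : ℂ[X]) : ℂ :=
  ∑ k ∈ Finset.range (n + 1), p.coeff k * F.coeff (n - k) / (n.choose k : ℂ)

/-- Removing a root `w` from one argument of the pairing costs a polar derivative of the other with
pole `-w`; this drives the induction for Grace's theorem. -/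
theorem apolarSum_mul_X_sub_C (n : ℕ) (p F : ℂ[X]) (w : ℂ) (hF : F.natDegree ≤ n) :
    ((n : ℂ) + 1) * apolarSum (n + 1) p ((X - C w) * F) =
      apolarSum n (C ((n : ℂ) + 1) * p - X * derivative p + C (-w) * derivative p) F := by
  have hn : ((n : ℂ) + 1) ≠ 0 := Nat.cast_add_one_ne_zero n
  have e1 : ∀ k ≤ n + 1, ((X - C w) * F).coeff (n + 1 - k) =
      (if k ≤ n then F.coeff (n - k) else 0) - w * (if k = 0 then 0 else F.coeff (n + 1 - k)) := by
    intro k hk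
    rw [sub_mul, coeff_sub, coeff_C_mul]
    congr 1
    · split_ifs with h
      · rw [show n + 1 - k = (n - k) + 1 by omega, coeff_X_mul]
      · rw [show n + 1 - k = 0 by omega, mul_coeff_zero, coeff_X_zero, zero_mul]
    · split_ifs with h
      · subst h
        rw [coeff_eq_zero_of_natDegree_lt (by omega)]
      · rfl
  have e2 : ∀ k ≤ n, (C ((n : ℂ) + 1) * p - X * derivative p + C (-w) * derivative p).coeff k =
      ((n : ℂ) + 1 - k) * p.coeff k - w * ((k + 1) * p.coeff (k + 1)) := by
    intro k _
    rw [coeff_add, coeff_sub, coeff_C_mul, coeff_C_mul, coeff_derivative]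
    cases k with
    | zero => simp; ring
    | succ k => rw [coeff_X_mul, coeff_derivative]; push_cast; ring
  have s1 : apolarSum (n + 1) p ((X - C w) * F) =
      ∑ k ∈ Finset.range (n + 1), p.coeff k * F.coeff (n - k) / ((n + 1).choose k : ℂ)
      - ∑ k ∈ Finset.range (n + 1),
          w * (p.coeff (k + 1) * F.coeff (n - k)) / ((n + 1).choose (k + 1) : ℂ) := by
    have a1 : apolarSum (n + 1) p ((X - C w) * F) =
        ∑ k ∈ Finset.range (n + 1 + 1),
          (p.coeff k * (if k ≤ n then F.coeff (n - k) else 0)) / ((n + 1).choose k : ℂ)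
        - ∑ k ∈ Finset.range (n + 1 + 1),
          w * (p.coeff k * (if k = 0 then 0 else F.coeff (n + 1 - k))) /
            ((n + 1).choose k : ℂ) := by
      rw [apolarSum, ← Finset.sum_sub_distrib]
      refine Finset.sum_congr rfl fun k hk => ?_
      rw [e1 k (by simpa [Nat.lt_succ_iff] using hk)]
      ring
    rw [a1]
    congr 1
    · rw [Finset.sum_range_succ, if_neg (by omega), mul_zero, zero_div, add_zero]
      refine Finset.sum_congr rfl fun k hk => ?_
      rw [if_pos (by simpa [Nat.lt_succ_iff] using hk)]
    · rw [Finset.sum_range_succ']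
      simp
  rw [s1, apolarSum, ← Finset.sum_sub_distrib, Finset.mul_sum]
  refine Finset.sum_congr rfl fun k hk => ?_
  have hk : k ≤ n := by simpa [Nat.lt_succ_iff] using hk
  rw [e2 k hk]
  have c0 : (n.choose k : ℂ) ≠ 0 := by exact_mod_cast (Nat.choose_pos hk).ne'
  have c1 : ((n + 1).choose k : ℂ) ≠ 0 := by
    exact_mod_cast (Nat.choose_pos (show k ≤ n + 1 by omega)).ne'
  have c2 : ((n + 1).choose (k + 1) : ℂ) ≠ 0 := by
    exact_mod_cast (Nat.choose_pos (show k + 1 ≤ n + 1 by omega)).ne'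
  have r1 : ((n : ℂ) + 1) * (n.choose k : ℂ) = ((n + 1).choose k : ℂ) * ((n : ℂ) + 1 - k) := by
    have h3 := Nat.choose_mul_succ_eq n k
    have h4 : (((n.choose k * (n + 1) : ℕ)) : ℂ) = (((n + 1).choose k * (n + 1 - k) : ℕ) : ℂ) := by
      rw [h3]
    push_cast [Nat.cast_sub (show k ≤ n + 1 by omega)] at h4
    linear_combination h4
  have r2 : ((n : ℂ) + 1) * (n.choose k : ℂ) = ((n + 1).choose (k + 1) : ℂ) * ((k : ℂ) + 1) := by
    exact_mod_cast Nat.add_one_mul_choose_eq n k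
  have t1 : ((n : ℂ) + 1) / ((n + 1).choose k : ℂ) = ((n : ℂ) + 1 - k) / (n.choose k : ℂ) := by
    rw [div_eq_div_iff c1 c0]; linear_combination r1
  have t2 : ((n : ℂ) + 1) / ((n + 1).choose (k + 1) : ℂ) = ((k : ℂ) + 1) / (n.choose k : ℂ) := by
    rw [div_eq_div_iff c2 c0]; linear_combination r2
  linear_combination (p.coeff k * F.coeff (n - k)) * t1 - (w * p.coeff (k + 1) * F.coeff (n - k)) * t2

/-- Walsh's coincidence theorem in the form of Grace's apolarity theorem for half-planes. -/
theorem UpperStable.apolarSum_ne_zero (n : ℕ) : ∀ p F : ℂ[X], UpperStable p → p.natDegree ≤ n →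
    F ≠ 0 → F.natDegree = n → (∀ w, F.eval w = 0 → w.im < 0) → apolarSum n p F ≠ 0 := by
  induction n with
  | zero =>
    intro p F hp hpd hF0 hFd _
    have h1 : p.coeff 0 ≠ 0 := by
      intro h
      apply hp Complex.I (by simp)
      rw [eq_C_of_natDegree_le_zero hpd, h]; simp
    have h2 : F.coeff 0 ≠ 0 := by
      intro h
      apply hF0
      rw [eq_C_of_natDegree_eq_zero hFd, h]; simp
    simp [apolarSum, h1, h2]
  | succ n ih =>
    intro p F hp hpd hF0 hFd hF h
    obtain ⟨w, hw⟩ := Complex.exists_root (f := F)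
      (natDegree_pos_iff_degree_pos.1 (by omega))
    obtain ⟨G, rfl⟩ := dvd_iff_isRoot.2 hw
    have hG0 : G ≠ 0 := right_ne_zero_of_mul hF0
    have hGd : G.natDegree = n := by
      rw [natDegree_mul (X_sub_C_ne_zero w) hG0, natDegree_X_sub_C] at hFd
      omega
    have hw' : 0 < (-w).im := by
      have := hF w hw
      simpa using this
    refine ih _ G (hp.polar hpd hw') ?_ hG0 hGd (fun v hv => hF v (by simp [hv])) ?_
    · rw [natDegree_le_iff_coeff_eq_zero]
      intro k hk
      rw [coeff_add, coeff_sub, coeff_C_mul, coeff_C_mul, coeff_derivative,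
        coeff_eq_zero_of_natDegree_lt (show p.natDegree < k + 1 by omega)]
      obtain ⟨k, rfl⟩ : ∃ j, k = j + 1 := ⟨k - 1, by omega⟩
      rw [coeff_X_mul, coeff_derivative]
      by_cases hkn : k = n
      · subst hkn; ring
      · rw [coeff_eq_zero_of_natDegree_lt (show p.natDegree < k + 1 by omega)]
        ring
    · rw [← apolarSum_mul_X_sub_C n p G w hGd.le, h, mul_zero]

/-! ### Multiplicative and additive finite free convolution -/

theorem seqPoly_natDegree {n : ℕ} {c : ℕ → ℝ} (h : c n ≠ 0) : (seqPoly n c).natDegree = n := by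
  refine natDegree_eq_of_le_of_coeff_ne_zero (seqPoly_natDegree_le n c) ?_
  rw [seqPoly_coeff, if_pos le_rfl]
  exact_mod_cast h

theorem seqPoly_ne_zero {n : ℕ} {c : ℕ → ℝ} (h : c n ≠ 0) : seqPoly n c ≠ 0 := by
  intro h0
  have := seqPoly_coeff n c n
  rw [h0, if_pos le_rfl, coeff_zero] at this
  exact h (by exact_mod_cast this.symm)

/-- The Schur–Szegő composition theorem. -/
theorem RealRootedSeq.mul {n : ℕ} {p q : ℕ → ℝ} (hp : RealRootedSeq n p)
    (hq : RealRootedSeq n q) (hpos : ∀ k ≤ n, 0 < q k) :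
    RealRootedSeq n (fun k => p k * q k / (n.choose k : ℝ)) := by
  intro x hx h
  have hx0 : x ≠ 0 := by rintro rfl; simp at hx
  set Q := seqPoly n (fun k => q (n - k)) with hQ
  have hq0 : (fun k => q (n - k)) n ≠ 0 := by simpa using (hpos 0 (by omega)).ne'
  have hQd : Q.natDegree = n := seqPoly_natDegree hq0
  have hQ0 : Q ≠ 0 := seqPoly_ne_zero hq0
  -- The value at `x` is the pairing of `p` with the reversed `q` whose roots are multiplied by `x`;
  -- negative roots times a point of the upper half-plane lie in the lower one.
  refine UpperStable.apolarSum_ne_zero n (seqPoly n p) (Q.scaleRoots x) hp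
    (seqPoly_natDegree_le n p) (scaleRoots_ne_zero hQ0 x)
    (by rw [natDegree_scaleRoots, hQd]) ?_ ?_
  · intro w hw
    have hw' : w = x * (w / x) := by field_simp
    rw [hw', scaleRoots_eval_mul, mul_eq_zero] at hw
    have hr := hw.resolve_left (pow_ne_zero _ hx0)
    obtain ⟨h1, h2⟩ := hq.reverse.neg_root (fun k _ => hpos (n - k) (by omega)) hr
    rw [hw', Complex.mul_im, h1]
    nlinarith
  · rw [← h, seqPoly_eval, apolarSum]
    refine Finset.sum_congr rfl fun k hk => ?_
    have hk : k ≤ n := by simpa [Nat.lt_succ_iff] using hk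
    rw [coeff_scaleRoots, hQd, hQ, seqPoly_coeff, seqPoly_coeff, if_pos hk, if_pos (by omega)]
    rw [show n - (n - k) = k by omega]
    push_cast
    ring

theorem hasseDeriv_seqPoly_eval (n m : ℕ) (c : ℕ → ℝ) (x : ℂ) :
    (hasseDeriv m (seqPoly n c)).eval x =
      ∑ i ∈ Finset.range (n + 1), (c i : ℂ) * (i.choose m : ℂ) * x ^ (i - m) := by
  simp only [seqPoly, map_sum, eval_finsetSum, C_mul_X_pow_eq_monomial, hasseDeriv_monomial,
    eval_monomial]
  exact Finset.sum_congr rfl fun i _ => by ring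

/-- The finite free additive convolution of real-rooted polynomials is real-rooted,
stated for reversed polynomials. -/
theorem RealRootedSeq.add {n : ℕ} {a b : ℕ → ℝ}
    (ha : RealRootedSeq n (fun k => n.choose k * a k))
    (hb : RealRootedSeq n (fun k => n.choose k * b k)) (hb0 : b 0 ≠ 0) :
    RealRootedSeq n (fun m => n.choose m *
      ∑ i ∈ Finset.range (m + 1), (m.choose i : ℝ) * b i * a (m - i)) := by
  set r : ℕ → ℝ := fun m => n.choose m *
      ∑ i ∈ Finset.range (m + 1), (m.choose i : ℝ) * b i * a (m - i) with hr
  suffices RealRootedSeq n (fun k => r (n - k)) from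
    this.reverse.congr fun k hk => by simp only [show n - (n - k) = k by omega]
  intro x hx h
  set Q := seqPoly n (fun k => (fun k => (n.choose k : ℝ) * b k) (n - k)) with hQ
  have hq0 : (fun k => (fun k => (n.choose k : ℝ) * b k) (n - k)) n ≠ 0 := by simpa using hb0
  have hQd : Q.natDegree = n := seqPoly_natDegree hq0
  have hQ0 : Q ≠ 0 := seqPoly_ne_zero hq0
  -- The reversed convolution at `x` is a pairing with `Q(x + ·)`, whose zeros are real numbers
  -- minus `x`.
  refine UpperStable.apolarSum_ne_zero n _ (taylor x Q) ha.reverse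
    (seqPoly_natDegree_le n _) ?_ (by rw [natDegree_taylor, hQd]) ?_ ?_
  · intro h0
    exact hQ0 (taylor_injective x (by rw [h0, map_zero]))
  · intro w hw
    rw [taylor_eval] at hw
    have := hb.reverse.im_eq_zero hw
    simp at this
    linarith
  · rw [← h, seqPoly_eval, apolarSum]
    have e1 : ∀ k ∈ Finset.range (n + 1),
        (seqPoly n (fun k => (fun k => (n.choose k : ℝ) * a k) (n - k))).coeff k *
          (taylor x Q).coeff (n - k) / (n.choose k : ℂ) =
        ∑ i ∈ Finset.range (n + 1), (a (n - k) : ℂ) * (b i : ℂ) * (n.choose i : ℂ) *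
          ((n - i).choose (n - k) : ℂ) * x ^ (n - i - (n - k)) := by
      intro k hk
      have hk : k ≤ n := by simpa [Nat.lt_succ_iff] using hk
      have c0 : (n.choose k : ℂ) ≠ 0 := by exact_mod_cast (Nat.choose_pos hk).ne'
      rw [seqPoly_coeff, if_pos hk, taylor_coeff, hQ, hasseDeriv_seqPoly_eval,
        ← Finset.sum_range_reflect]
      simp only [Nat.choose_symm hk]
      push_cast
      rw [mul_assoc, mul_div_cancel_left₀ _ c0, Finset.mul_sum]
      refine Finset.sum_congr rfl fun i hi => ?_
      have hi : i ≤ n := by simpa [Nat.lt_succ_iff] using hi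
      rw [show n - (n - i) = i by omega]
      ring
    rw [Finset.sum_congr rfl e1, ← Finset.sum_range_reflect]
    have e2 : ∀ f : ℕ → ℂ, ∑ k ∈ Finset.range (n + 1), f k =
        ∑ k ∈ Finset.range (n + 1), f (n - k) := fun f => by
      rw [← Finset.sum_range_reflect]; rfl
    rw [e2 (fun k => ((r (n - k) : ℝ) : ℂ) * x ^ k), Finset.sum_comm]
    let f : ℕ → ℕ → ℂ := fun i j => (a j : ℂ) * (b i : ℂ) * (n.choose i : ℂ) *
      ((n - i).choose j : ℂ) * x ^ (n - i - j)
    have e3 : ∀ m ∈ Finset.range (n + 1), ((r (n - (n - m)) : ℝ) : ℂ) * x ^ (n - m) =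
        ∑ i ∈ Finset.range (m + 1), f i (m - i) := by
      intro m hm
      have hm : m ≤ n := by simpa [Nat.lt_succ_iff] using hm
      rw [show n - (n - m) = m by omega, hr]
      push_cast
      rw [Finset.mul_sum, Finset.sum_mul]
      refine Finset.sum_congr rfl fun i hi => ?_
      have hi : i ≤ m := by simpa [Nat.lt_succ_iff] using hi
      have h1 : (n.choose m : ℂ) * (m.choose i : ℂ) =
          (n.choose i : ℂ) * ((n - i).choose (m - i) : ℂ) := by
        exact_mod_cast Nat.choose_mul hi
      simp only [f]
      rw [show n - i - (m - i) = n - m by omega]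
      linear_combination ((b i : ℂ) * a (m - i) * x ^ (n - m)) * h1
    rw [Finset.sum_congr rfl e3, Finset.sum_range_diag_flip (n + 1) f]
    refine Finset.sum_congr rfl fun i hi => ?_
    have hi : i ≤ n := by simpa [Nat.lt_succ_iff] using hi
    symm
    have e4 : ∀ j ∈ Finset.range (n + 1),
        (a (n - (n + 1 - 1 - j)) : ℂ) * (b i : ℂ) * (n.choose i : ℂ) *
          ((n - i).choose (n - (n + 1 - 1 - j)) : ℂ) * x ^ (n - i - (n - (n + 1 - 1 - j))) =
        (a j : ℂ) * (b i : ℂ) * (n.choose i : ℂ) *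
          ((n - i).choose j : ℂ) * x ^ (n - i - j) := by
      intro j hj
      have hj : j ≤ n := by simpa [Nat.lt_succ_iff] using hj
      rw [show n - (n + 1 - 1 - j) = j by omega]
    rw [Finset.sum_congr rfl e4]
    simp only [f]
    refine Finset.sum_subset (fun j => by simp; omega) fun j _ hj => ?_
    rw [Finset.mem_range] at hj
    rw [Nat.choose_eq_zero_of_lt (show n - i < j by omega)]
    simp

/-! ### Rolle-type multipliers -/

theorem seqPoly_X_mul_derivative_eval (n : ℕ) (c : ℕ → ℝ) (x : ℂ) :
    x * (derivative (seqPoly n c)).eval x =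
      ∑ k ∈ Finset.range (n + 1), ((k * c k : ℝ) : ℂ) * x ^ k := by
  simp only [seqPoly, derivative_sum, eval_finsetSum, Finset.mul_sum]
  refine Finset.sum_congr rfl fun k _ => ?_
  cases k with
  | zero => simp
  | succ k => simp; ring

/-- At a zero `x` of `c p + x p'` in the upper half-plane, `p'/p = -c/x` has positive imaginary
part, whereas real zeros of `p` force it to be nonpositive. -/
theorem RealRootedSeq.add_mul {n : ℕ} {p : ℕ → ℝ} (hp : RealRootedSeq n p) {c : ℝ}
    (hc : 0 < c) : RealRootedSeq n (fun k => (c + k) * p k) := by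
  intro x hx h
  have hx0 : x ≠ 0 := by rintro rfl; simp at hx
  have hpx := hp x hx
  have h1 : x * (derivative (seqPoly n p)).eval x + c * (seqPoly n p).eval x = 0 := by
    rw [← h, seqPoly_X_mul_derivative_eval, seqPoly_eval, seqPoly_eval, Finset.mul_sum,
      ← Finset.sum_add_distrib]
    refine Finset.sum_congr rfl fun k _ => ?_
    push_cast
    ring
  have h2 := re_mul_logDeriv_ge (seqPoly n p) Complex.I x 0 hpx (fun a ha => by
    have h3 := hp.im_eq_zero ha
    rw [Complex.div_re, ← add_div]
    refine div_nonneg ?_ (Complex.normSq_nonneg _)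
    simp [h3]
    linarith)
  have h4 : (derivative (seqPoly n p)).eval x / (seqPoly n p).eval x = -c / x := by
    field_simp
    linear_combination h1
  rw [h4, zero_mul] at h2
  have h5 : (Complex.I * (-c / x)).re = - (c * (x.im / Complex.normSq x)) := by
    simp [Complex.div_im, Complex.div_re]
    ring
  rw [h5] at h2
  have : 0 < c * (x.im / Complex.normSq x) := by
    have := Complex.normSq_pos.2 hx0
    positivity
  linarith

/-! ### Rising factorials -/

/-- The rising factorial `(c)ₖ`. -/
noncomputable def rising (c : ℝ) (k : ℕ) : ℝ := (ascPochhammer ℝ k).eval c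

@[simp]
theorem rising_zero (c : ℝ) : rising c 0 = 1 := by simp [rising]

@[simp]
theorem rising_one (c : ℝ) : rising c 1 = c := by simp [rising]

theorem rising_succ (c : ℝ) (k : ℕ) : rising c (k + 1) = rising c k * (c + k) :=
  ascPochhammer_succ_eval k c

theorem rising_add (c : ℝ) (k m : ℕ) : rising c (k + m) = rising c k * rising (c + k) m := by
  induction m with
  | zero => simp
  | succ m ih => rw [← add_assoc, rising_succ, rising_succ, ih]; push_cast; ring

theorem rising_succ' (c : ℝ) (k : ℕ) : rising c (k + 1) = c * rising (c + 1) k := by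
  rw [add_comm, rising_add]; simp

theorem rising_pos {c : ℝ} (hc : 0 < c) (k : ℕ) : 0 < rising c k := ascPochhammer_pos k c hc

theorem rising_ne_zero {c : ℝ} {k : ℕ} (h : ∀ m : ℕ, m < k → c ≠ -(m : ℝ)) :
    rising c k ≠ 0 := by
  induction k with
  | zero => simp
  | succ k ih =>
    rw [rising_succ]
    refine mul_ne_zero (ih fun m hm => h m (by omega)) fun h0 => h k (by omega) (by linarith)

/-! ### Laguerre polynomials -/

theorem choose_pascal_real {n k : ℕ} :
    (((n + 1).choose (k + 1) : ℕ) : ℝ) = n.choose k + n.choose (k + 1) := by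
  exact_mod_cast Nat.choose_succ_succ n k

theorem seqPoly_X_mul_eval (n : ℕ) (c : ℕ → ℝ) (x : ℂ) :
    (seqPoly (n + 1) (fun k => if k = 0 then 0 else c (k - 1))).eval x =
      x * (seqPoly n c).eval x := by
  rw [seqPoly_eval, seqPoly_eval, Finset.sum_range_succ', Finset.mul_sum]
  simp
  exact Finset.sum_congr rfl fun k _ => by ring

theorem seqPoly_add_eval (n : ℕ) (c d : ℕ → ℝ) (x : ℂ) :
    (seqPoly n (fun k => c k + d k)).eval x = (seqPoly n c).eval x + (seqPoly n d).eval x := by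
  simp [seqPoly_eval, _root_.add_mul, Finset.sum_add_distrib]

theorem seqPoly_succ_eval {n : ℕ} {c : ℕ → ℝ} (h : c (n + 1) = 0) (x : ℂ) :
    (seqPoly (n + 1) c).eval x = (seqPoly n c).eval x := by
  rw [seqPoly_eval, seqPoly_eval, Finset.sum_range_succ, h]
  simp

theorem seqPoly_add_mul_eval (n : ℕ) (c : ℕ → ℝ) (b : ℝ) (x : ℂ) :
    (seqPoly n (fun k => (b + k) * c k)).eval x =
      b * (seqPoly n c).eval x + x * (derivative (seqPoly n c)).eval x := by
  rw [seqPoly_X_mul_derivative_eval, seqPoly_eval, seqPoly_eval, Finset.mul_sum,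
    ← Finset.sum_add_distrib]
  refine Finset.sum_congr rfl fun k _ => ?_
  push_cast
  ring

/-- Coefficients of the Laguerre polynomial with parameter `b - 1` at `-x`, up to a factor. -/
noncomputable def laguerreCoeff (n : ℕ) (b : ℝ) (k : ℕ) : ℝ :=
  n.choose k * rising (b + k) (n - k)

theorem laguerreCoeff_pos {n k : ℕ} {b : ℝ} (hb : 0 < b) (hk : k ≤ n) :
    0 < laguerreCoeff n b k :=
  mul_pos (by exact_mod_cast Nat.choose_pos hk) (rising_pos (by positivity) _)

theorem laguerreCoeff_succ (n k : ℕ) (b : ℝ) (hk : k ≤ n + 1) :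
    laguerreCoeff (n + 1) b k = (b + k) * laguerreCoeff n (b + 1) k +
      (if k = 0 then 0 else laguerreCoeff n (b + 1) (k - 1)) := by
  unfold laguerreCoeff
  have e : ∀ k ≤ n, (b + k) * (n.choose k * rising (b + 1 + k) (n - k)) =
      n.choose k * rising (b + k) (n + 1 - k) := by
    intro k hk
    rw [show n + 1 - k = (n - k) + 1 by omega, rising_succ', show b + 1 + k = b + k + 1 by ring]
    ring
  cases k with
  | zero =>
    rw [e 0 (by omega)]
    simp
  | succ k =>
    have h2 : n.choose (k + 1) * rising (b + ((k + 1 : ℕ) : ℝ)) (n + 1 - (k + 1)) =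
        (b + ((k + 1 : ℕ) : ℝ)) *
          (n.choose (k + 1) * rising (b + 1 + ((k + 1 : ℕ) : ℝ)) (n - (k + 1))) := by
      by_cases h : k + 1 ≤ n
      · rw [e (k + 1) h]
      · rw [Nat.choose_eq_zero_of_lt (by omega)]; simp
    rw [choose_pascal_real, _root_.add_mul, h2]
    simp only [Nat.add_sub_cancel, Nat.add_sub_add_right, if_neg (Nat.succ_ne_zero k)]
    push_cast
    rw [show b + ((k : ℝ) + 1) = b + 1 + k by ring]
    ring

/-- Induction on `L_{n+1}^b = (b + x + x d/dx) L_n^{b+1}`: negative zeros of `F` give `Im(x F'/F) ≥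
0`, but a zero of the new polynomial would make it `-Im x`. Only `b+1 > 0` is used, hence the range
`b > -1`. -/
theorem realRootedSeq_laguerreCoeff (n : ℕ) : ∀ b : ℝ, -1 < b →
    RealRootedSeq n (laguerreCoeff n b) := by
  induction n with
  | zero =>
    intro b _ x _
    simp [seqPoly_eval, laguerreCoeff]
  | succ n ih =>
    intro b hb x hx h
    have hF := ih (b + 1) (by linarith)
    set F := seqPoly n (laguerreCoeff n (b + 1)) with hFdef
    have hpx : F.eval x ≠ 0 := hF x hx
    rw [seqPoly_congr (fun k hk => laguerreCoeff_succ n k b hk), seqPoly_add_eval,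
      seqPoly_X_mul_eval, seqPoly_succ_eval (by simp [laguerreCoeff]),
      seqPoly_add_mul_eval] at h
    have h1 : x * (derivative F).eval x / F.eval x = -b - x := by
      field_simp
      linear_combination h
    have h2 := re_mul_logDeriv_ge F (-Complex.I * x) x 0 hpx (fun a ha => by
      obtain ⟨h3, h4⟩ := hF.neg_root
        (fun k hk => laguerreCoeff_pos (by linarith) hk) ha
      rw [Complex.div_re, ← add_div]
      refine div_nonneg ?_ (Complex.normSq_nonneg _)
      simp [h3]
      nlinarith)
    rw [mul_assoc, ← mul_div_assoc, h1] at h2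
    simp at h2
    linarith

/-! ### Jacobi polynomials -/

/-- Coefficients of a Jacobi polynomial, up to an affine change of the variable and a factor. -/
noncomputable def jacobiCoeff (n : ℕ) (a b : ℝ) (k : ℕ) : ℝ :=
  n.choose k * rising a k * rising (b + k) (n - k)

theorem jacobiCoeff_pos {n k : ℕ} {a b : ℝ} (ha : 0 < a) (hb : 0 < b) (hk : k ≤ n) :
    0 < jacobiCoeff n a b k :=
  mul_pos (mul_pos (by exact_mod_cast Nat.choose_pos hk) (rising_pos ha _))
    (rising_pos (by positivity) _)

theorem jacobiCoeff_succ (n k : ℕ) (a b : ℝ) (hk : k ≤ n + 1) :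
    jacobiCoeff (n + 1) a b k = (b + k) * jacobiCoeff n (a + 1) (b + 1) k +
      (if k = 0 then 0 else (a - n + (k - 1 : ℕ)) * jacobiCoeff n (a + 1) (b + 1) (k - 1)) := by
  unfold jacobiCoeff
  have e : ∀ k ≤ n, (b + k) * rising (b + 1 + k) (n - k) = rising (b + k) (n + 1 - k) := by
    intro k hk
    rw [show n + 1 - k = (n - k) + 1 by omega, rising_succ', show b + 1 + k = b + k + 1 by ring]
  cases k with
  | zero =>
    have := e 0 (by omega)
    simp at this ⊢
    exact this.symm
  | succ k =>
    have h2 : (b + ((k + 1 : ℕ) : ℝ)) * (n.choose (k + 1) * rising (a + 1) (k + 1) *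
          rising (b + 1 + ((k + 1 : ℕ) : ℝ)) (n - (k + 1))) =
        n.choose (k + 1) * rising (a + 1) (k + 1) *
          rising (b + ((k + 1 : ℕ) : ℝ)) (n + 1 - (k + 1)) := by
      by_cases h : k + 1 ≤ n
      · rw [← e (k + 1) h]; ring
      · rw [Nat.choose_eq_zero_of_lt (by omega)]; simp
    rw [h2, rising_succ', rising_succ]
    simp only [Nat.add_sub_cancel, Nat.add_sub_add_right, if_neg (Nat.succ_ne_zero k)]
    have h3 : ((n : ℝ) + 1) * n.choose k = (n + 1).choose (k + 1) * (k + 1) := by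
      exact_mod_cast Nat.add_one_mul_choose_eq n k
    rw [choose_pascal_real] at h3 ⊢
    push_cast
    rw [show b + ((k : ℝ) + 1) = b + 1 + k by ring]
    linear_combination (rising (a + 1) k * rising (b + 1 + k) (n - k)) * h3

theorem jacobiCoeff_eval_succ (n : ℕ) (a b : ℝ) (x : ℂ) :
    (seqPoly (n + 1) (jacobiCoeff (n + 1) a b)).eval x =
      x * (1 + x) * (derivative (seqPoly n (jacobiCoeff n (a + 1) (b + 1)))).eval x +
      (b + (a - n) * x) * (seqPoly n (jacobiCoeff n (a + 1) (b + 1))).eval x := by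
  rw [seqPoly_congr (fun k hk => jacobiCoeff_succ n k a b hk), seqPoly_add_eval,
    seqPoly_X_mul_eval n (fun k => (a - n + k) * jacobiCoeff n (a + 1) (b + 1) k),
    seqPoly_succ_eval (by simp [jacobiCoeff]),
    seqPoly_add_mul_eval, seqPoly_add_mul_eval]
  push_cast
  ring

theorem jacobi_upperStable_succ {n : ℕ} {a b : ℝ} (ha : 0 < a)
    (hF : ∀ z, (seqPoly n (jacobiCoeff n (a + 1) (b + 1))).eval z = 0 →
      z.im = 0 ∧ -1 < z.re ∧ z.re < 0) :
    RealRootedSeq (n + 1) (jacobiCoeff (n + 1) a b) := by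
  intro x hx h
  have hc : jacobiCoeff n (a + 1) (b + 1) n ≠ 0 := by
    simpa [jacobiCoeff] using (rising_pos (show 0 < a + 1 by linarith) n).ne'
  rw [jacobiCoeff_eval_succ] at h
  have hd := seqPoly_natDegree hc
  set F := seqPoly n (jacobiCoeff n (a + 1) (b + 1)) with hFdef
  have hpx : F.eval x ≠ 0 := fun h0 => hx.ne' (hF x h0).1
  have h1 : x * (1 + x) * (derivative F).eval x / F.eval x = -(b + (a - n) * x) := by
    field_simp
    linear_combination h
  -- From `x(1+x)/(x-z) = x + 1 + z + z(1+z)/(x-z)` with `z ∈ (-1,0)`, each term has imaginary part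
  -- at least `Im x`. The sum is then at least `n Im x`, while `h1` gives `(n-a) Im x`.
  have h2 := re_mul_logDeriv_ge F (-Complex.I * (x * (1 + x))) x x.im hpx (fun z hz => by
    obtain ⟨h3, h4, h5⟩ := hF z hz
    have hxz : x - z ≠ 0 := by
      intro h0
      have := congrArg Complex.im h0
      simp [h3] at this
      linarith
    rw [Complex.div_re, ← add_div, le_div_iff₀ (Complex.normSq_pos.2 hxz)]
    simp [h3, Complex.normSq_apply]
    have : 0 ≤ x.im * (-z.re * (1 + z.re)) :=
      mul_nonneg hx.le (mul_nonneg (by linarith) (by linarith))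
    nlinarith)
  rw [mul_assoc, ← mul_div_assoc, h1, hd] at h2
  simp at h2
  nlinarith

theorem jacobi_roots (n : ℕ) : ∀ a b : ℝ, 0 < b → b + n - 1 < a → 0 < a →
    ∀ z, (seqPoly n (jacobiCoeff n a b)).eval z = 0 → z.im = 0 ∧ -1 < z.re ∧ z.re < 0 := by
  induction n with
  | zero =>
    intro a b _ _ _ z hz
    simp [seqPoly_eval, jacobiCoeff] at hz
  | succ n ih =>
    intro a b hb hab ha z hz
    push_cast at hab
    have hF := ih (a + 1) (b + 1) (by linarith) (by linarith) (by linarith)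
    obtain ⟨h1, h2⟩ := (jacobi_upperStable_succ ha hF).neg_root
      (fun k hk => jacobiCoeff_pos ha hb hk) hz
    refine ⟨h1, ?_, h2⟩
    -- For a real `z ≤ -1`, all terms of `-z(1+z)F'/F` are nonnegative, yet the sum is `b + (a-n)z <
    -- 0` because `a > b+n`.
    by_contra! h3
    rw [jacobiCoeff_eval_succ] at hz
    set F := seqPoly n (jacobiCoeff n (a + 1) (b + 1)) with hFdef
    have hpz : F.eval z ≠ 0 := fun h0 => by have := (hF z h0).2.1; linarith
    have h4 : z * (1 + z) * (derivative F).eval z / F.eval z = -(b + (a - n) * z) := by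
      field_simp
      linear_combination hz
    have h5 := re_mul_logDeriv_ge F (-(z * (1 + z))) z 0 hpz (fun w hw => by
      obtain ⟨h6, h7, h8⟩ := hF w hw
      rw [Complex.div_re, ← add_div]
      refine div_nonneg ?_ (Complex.normSq_nonneg _)
      simp [h6, h1]
      have : 0 ≤ -z.re * (-(1 + z.re)) := mul_nonneg (by linarith) (by linarith)
      nlinarith)
    rw [neg_mul, ← mul_div_assoc, h4, zero_mul] at h5
    simp at h5
    nlinarith

/-- Only the preceding polynomial needs its zeros in `(-1,0)`, which gains 1 over the bound in
`jacobi_roots` and yields the threshold `t > n-2`. -/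
theorem realRootedSeq_jacobiCoeff {n : ℕ} {a b : ℝ} (hb : 0 < b) (ha : 0 < a)
    (hab : b + n - 2 < a) : RealRootedSeq n (jacobiCoeff n a b) := by
  cases n with
  | zero => intro x _; simp [seqPoly_eval, jacobiCoeff]
  | succ n =>
    push_cast at hab
    exact jacobi_upperStable_succ ha
      (jacobi_roots n (a + 1) (b + 1) (by linarith) (by linarith) (by linarith))

/-! ### Duplication, reflection and Chu–Vandermonde -/

theorem rising_two_mul (c : ℝ) (k : ℕ) :
    rising c (2 * k) = 4 ^ k * rising (c / 2) k * rising ((c + 1) / 2) k := by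
  induction k with
  | zero => simp
  | succ k ih =>
    rw [show 2 * (k + 1) = 2 * k + 1 + 1 by ring, rising_succ, rising_succ, ih, rising_succ,
      rising_succ]
    push_cast
    ring

theorem neg_one_pow_mul_rising (a : ℝ) (k : ℕ) :
    (-1) ^ k * rising a k = rising (1 - a - k) k := by
  induction k with
  | zero => simp
  | succ k ih =>
    rw [rising_succ a, rising_succ']
    push_cast
    rw [show 1 - a - ((k : ℝ) + 1) + 1 = 1 - a - k by ring, ← ih]
    ring

theorem rising_sub_ne_zero {b : ℝ} {n k : ℕ} (h : rising b n ≠ 0) (hk : k ≤ n) :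
    rising b k ≠ 0 := by
  obtain ⟨m, rfl⟩ := Nat.exists_eq_add_of_le hk
  rw [rising_add] at h
  exact left_ne_zero_of_mul h

theorem rising_ne_zero_of_neg_one_lt {b : ℝ} (h : -1 < b) (h0 : b ≠ 0) (k : ℕ) :
    rising b k ≠ 0 := by
  refine rising_ne_zero fun m _ hm => ?_
  rcases Nat.eq_zero_or_pos m with rfl | hm'
  · simp at hm; exact h0 hm
  · have : (1 : ℝ) ≤ m := by exact_mod_cast hm'
    linarith

theorem rising_sub_eq_div {b : ℝ} {n k : ℕ} (h : rising b n ≠ 0) (hk : k ≤ n) :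
    rising (b + k) (n - k) = rising b n / rising b k := by
  rw [eq_div_iff (rising_sub_ne_zero h hk), mul_comm, ← rising_add, Nat.add_sub_cancel' hk]

/-- The Chu–Vandermonde identity. -/
theorem sum_choose_mul_rising (b b' : ℝ) (m : ℕ) :
    ∑ i ∈ Finset.range (m + 1),
      (m.choose i : ℝ) * (rising (b' + (m - i : ℕ)) i * rising (b + i) (m - i)) =
    rising (b + b' + m - 1) m := by
  have e : ∀ (r : ℝ) (i : ℕ), (descPochhammer ℤ i).smeval r = rising (r - i + 1) i := by
    intro r i
    rw [descPochhammer_smeval_eq_ascPochhammer, ascPochhammer_smeval_eq_eval, rising]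
  have h := Ring.descPochhammer_smeval_add (r := b' + m - 1) (s := b + m - 1) m
    (Commute.all _ _)
  rw [Finset.Nat.sum_antidiagonal_eq_sum_range_succ_mk, e] at h
  rw [show b + b' + m - 1 = b' + m - 1 + (b + m - 1) - m + 1 by ring, h]
  refine Finset.sum_congr rfl fun i hi => ?_
  have hi : i ≤ m := by simpa [Nat.lt_succ_iff] using hi
  simp only [e]
  rw [Nat.cast_sub hi, show b' + m - 1 - i + 1 = b' + (m - i) by ring,
    show b + m - 1 - (m - i : ℝ) + 1 = b + i by ring]

theorem sum_choose_div_rising {b b' : ℝ} {m : ℕ} (hb : rising b m ≠ 0) (hb' : rising b' m ≠ 0) :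
    ∑ i ∈ Finset.range (m + 1), (m.choose i : ℝ) * (rising b i)⁻¹ * (rising b' (m - i))⁻¹ =
      rising (b + b' + m - 1) m / (rising b m * rising b' m) := by
  rw [← sum_choose_mul_rising, Finset.sum_div]
  refine Finset.sum_congr rfl fun i hi => ?_
  have hi : i ≤ m := by simpa [Nat.lt_succ_iff] using hi
  have h1 := rising_sub_ne_zero hb hi
  have h2 := rising_sub_ne_zero hb' (Nat.sub_le m i)
  have h3 := rising_sub_eq_div hb hi
  have h4 := rising_sub_eq_div hb' (Nat.sub_le m i)
  rw [show m - (m - i) = i by omega] at h4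
  rw [h3, h4]
  field_simp

/-! ### Products of two Bessel-type series -/

theorem realRootedSeq_inv_rising (n : ℕ) {b : ℝ} (hb : -1 < b) (h0 : b ≠ 0) :
    RealRootedSeq n (fun k => n.choose k * (rising b k)⁻¹) := by
  have hn := rising_ne_zero_of_neg_one_lt hb h0 n
  refine ((realRootedSeq_laguerreCoeff n b hb).const_mul (inv_ne_zero hn)).congr fun k hk => ?_
  rw [laguerreCoeff, rising_sub_eq_div hn hk]
  field_simp

theorem realRootedSeq_bessel_product (n : ℕ) {b b' : ℝ} (hb : -1 < b) (h0 : b ≠ 0)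
    (hb' : -1 < b') (h0' : b' ≠ 0) :
    RealRootedSeq n (fun k => n.choose k *
      (rising (b + b' + k - 1) k / (rising b k * rising b' k))) := by
  refine ((realRootedSeq_inv_rising n hb' h0').add (realRootedSeq_inv_rising n hb h0)
    (by simp)).congr fun k _ => ?_
  rw [sum_choose_div_rising (rising_ne_zero_of_neg_one_lt hb h0 k)
    (rising_ne_zero_of_neg_one_lt hb' h0' k)]

/-- The left side is `(s-1)_{2k}`, whose factors split by parity; this rewrites `(s+k-1)_k`, with `s
= b+b'`, through ordinary rising factorials. -/
theorem rising_duplication (s : ℝ) (k : ℕ) :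
    rising (s - 1) k * rising (s + k - 1) k =
      4 ^ k * rising ((s - 1) / 2) k * rising (s / 2) k := by
  have h := rising_two_mul (s - 1) k
  rw [two_mul, rising_add, show s - 1 + k = s + k - 1 by ring, show s - 1 + 1 = s by ring] at h
  exact h

/-- Coefficients of the terminating series ₂F₂(-n, a; b₁, b₂; -x). -/
noncomputable def hyperCoeff (n : ℕ) (a b₁ b₂ : ℝ) (k : ℕ) : ℝ :=
  n.choose k * (rising a k / (rising b₁ k * rising b₂ k))

theorem RealRootedSeq.hyperCoeff_swap {n : ℕ} {a b₁ b₂ : ℝ}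
    (h : RealRootedSeq n (hyperCoeff n a b₁ b₂)) : RealRootedSeq n (hyperCoeff n a b₂ b₁) :=
  h.congr fun k _ => by rw [hyperCoeff, hyperCoeff, mul_comm (rising b₁ k)]

theorem realRootedSeq_hyperCoeff_of_scale {n : ℕ} {a b₁ b₂ : ℝ}
    (h : RealRootedSeq n (fun k => 4 ^ k * hyperCoeff n a b₁ b₂ k)) :
    RealRootedSeq n (hyperCoeff n a b₁ b₂) :=
  (h.scale (show (0 : ℝ) < 1 / 4 by norm_num)).congr fun k _ => by
    rw [← mul_assoc, ← mul_pow]; norm_num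

theorem realRootedSeq_hyperCoeff_add_eq_two (n : ℕ) {b b' : ℝ} (hb : -1 < b) (h0 : b ≠ 0)
    (hb' : -1 < b') (h0' : b' ≠ 0) (h : b + b' = 2) :
    RealRootedSeq n (hyperCoeff n (1 / 2) b b') := by
  refine realRootedSeq_hyperCoeff_of_scale
    ((realRootedSeq_bessel_product n hb h0 hb' h0').congr fun k _ => ?_)
  have h1 := rising_duplication 2 k
  norm_num at h1
  rw [mul_comm, mul_left_inj' (rising_pos one_pos k).ne'] at h1
  rw [hyperCoeff, h, h1]
  ring

theorem realRootedSeq_hyperCoeff_two_mul_sub_one (n : ℕ) {b : ℝ} (hb : -1 < b) (h0 : b ≠ 0)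
    (h : rising (2 * b - 1) n ≠ 0) :
    RealRootedSeq n (hyperCoeff n (b - 1 / 2) b (2 * b - 1)) := by
  refine realRootedSeq_hyperCoeff_of_scale
    ((realRootedSeq_bessel_product n hb h0 hb h0).congr fun k hk => ?_)
  have h1 := rising_duplication (2 * b) k
  rw [show (2 * b - 1) / 2 = b - 1 / 2 by ring, show 2 * b / 2 = b by ring] at h1
  have h2 := rising_sub_ne_zero h hk
  have h3 := rising_ne_zero_of_neg_one_lt hb h0 k
  rw [hyperCoeff, show b + b + k - 1 = 2 * b + k - 1 by ring, ← mul_left_comm]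
  congr 1
  rw [← mul_div_assoc, div_eq_div_iff (by positivity) (by positivity)]
  linear_combination rising b k * h1

theorem realRootedSeq_hyperCoeff_two_mul_sub_two (n : ℕ) {b : ℝ} (hb : 0 < b) (h0 : b ≠ 1)
    (h : rising (2 * b - 2) n ≠ 0) :
    RealRootedSeq n (hyperCoeff n (b - 1 / 2) b (2 * b - 2)) := by
  have h0' : b - 1 ≠ 0 := sub_ne_zero.2 h0
  refine realRootedSeq_hyperCoeff_of_scale
    ((realRootedSeq_bessel_product n (by linarith) hb.ne' (show -1 < b - 1 by linarith)
      h0').congr fun k hk => ?_)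
  have h1 := rising_duplication (2 * b - 1) k
  rw [show (2 * b - 1 - 1) / 2 = b - 1 by ring, show (2 * b - 1) / 2 = b - 1 / 2 by ring,
    show 2 * b - 1 - 1 = 2 * b - 2 by ring] at h1
  have h2 := rising_sub_ne_zero h hk
  have h3 := (rising_pos hb k).ne'
  have h4 := rising_ne_zero_of_neg_one_lt (show -1 < b - 1 by linarith) h0' k
  rw [hyperCoeff, show b + (b - 1) + k - 1 = 2 * b - 1 + k - 1 by ring, ← mul_left_comm]
  congr 1
  rw [← mul_div_assoc, div_eq_div_iff (by positivity) (by positivity)]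
  linear_combination rising b k * h1

/-! ### Shifting parameters -/

theorem rising_add_one_mul (c : ℝ) (k : ℕ) : c * rising (c + 1) k = (c + k) * rising c k := by
  rw [← rising_succ', rising_succ, mul_comm]

theorem RealRootedSeq.hyperCoeff_upper {n : ℕ} {a b₁ b₂ : ℝ} (ha : 0 < a)
    (h : RealRootedSeq n (hyperCoeff n a b₁ b₂)) (m : ℕ) :
    RealRootedSeq n (hyperCoeff n (a + m) b₁ b₂) := by
  induction m with
  | zero => simpa using h
  | succ m ih =>
    have hpos : 0 < a + m := by positivity
    refine ((ih.add_mul hpos).const_mul (inv_ne_zero hpos.ne')).congr fun k _ => ?_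
    push_cast
    have := rising_add_one_mul (a + m) k
    rw [← add_assoc, hyperCoeff, hyperCoeff, inv_mul_eq_iff_eq_mul₀ hpos.ne']
    linear_combination -(n.choose k * (rising b₁ k * rising b₂ k)⁻¹) * this

theorem RealRootedSeq.hyperCoeff_lower_nat {n : ℕ} {a b₁ b₂ : ℝ} (hb : 0 < b₂) (m : ℕ)
    (h : RealRootedSeq n (hyperCoeff n a b₁ (b₂ + m))) :
    RealRootedSeq n (hyperCoeff n a b₁ b₂) := by
  induction m with
  | zero => simpa using h
  | succ m ih =>
    have hpos : 0 < b₂ + m := by positivity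
    refine ih (((h.add_mul hpos).const_mul (inv_ne_zero hpos.ne')).congr fun k _ => ?_)
    push_cast
    have h1 := rising_add_one_mul (b₂ + m) k
    have h2 := (rising_pos (show 0 < b₂ + m + 1 by linarith) k).ne'
    have h3 := (rising_pos hpos k).ne'
    rw [← add_assoc, hyperCoeff, hyperCoeff, inv_mul_eq_iff_eq_mul₀ hpos.ne']
    have h4 : (b₂ + m + k) * (rising (b₂ + m + 1) k)⁻¹ = (b₂ + m) * (rising (b₂ + m) k)⁻¹ := by
      field_simp
      linear_combination -h1
    rw [div_eq_mul_inv, div_eq_mul_inv, mul_inv, mul_inv]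
    linear_combination (n.choose k * (rising a k * (rising b₁ k)⁻¹)) * h4

/-- Schur–Szegő composition with a Jacobi polynomial multiplies the coefficients by
`(b₂+t)_k/(b₂)_k` up to a constant. -/
theorem RealRootedSeq.hyperCoeff_lower_real {n : ℕ} {a b₁ b₂ t : ℝ} (hb : 0 < b₂)
    (hbt : 0 < b₂ + t) (ht : (n : ℝ) - 2 < t)
    (h : RealRootedSeq n (hyperCoeff n a b₁ (b₂ + t))) :
    RealRootedSeq n (hyperCoeff n a b₁ b₂) := by
  have hn := (rising_pos hb n).ne'
  refine ((h.mul (realRootedSeq_jacobiCoeff hb hbt (by linarith))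
    fun k hk => jacobiCoeff_pos hbt hb hk).const_mul (inv_ne_zero hn)).congr fun k hk => ?_
  have h1 := (rising_pos hbt k).ne'
  have h2 := (rising_pos hb k).ne'
  have h3 : (n.choose k : ℝ) ≠ 0 := by exact_mod_cast (Nat.choose_pos hk).ne'
  rw [hyperCoeff, hyperCoeff, jacobiCoeff, rising_sub_eq_div hn hk]
  rw [div_eq_mul_inv (rising a k), div_eq_mul_inv (rising a k), mul_inv, mul_inv]
  field_simp

theorem RealRootedSeq.hyperCoeff_lower {n : ℕ} (hn : 2 ≤ n) {a b₁ b₂ t : ℝ} (hb : 0 < b₂)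
    (ht : (∃ m : ℕ, m < n ∧ t = m) ∨ (n : ℝ) - 2 < t)
    (h : RealRootedSeq n (hyperCoeff n a b₁ (b₂ + t))) :
    RealRootedSeq n (hyperCoeff n a b₁ b₂) := by
  rcases ht with ⟨m, _, rfl⟩ | ht
  · exact h.hyperCoeff_lower_nat hb m
  · have : (2 : ℝ) ≤ n := by exact_mod_cast hn
    exact h.hyperCoeff_lower_real hb (by linarith) ht

/-- Since `(-1)^k (a)_k = (1-a-k)_k`, the multiplier comes from the reversed Laguerre polynomial
with parameter `1-a-n > 0`. -/
theorem RealRootedSeq.mul_rising {n : ℕ} {p : ℕ → ℝ} (h : RealRootedSeq n p) {a : ℝ}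
    (ha : a < -(n : ℝ) + 1) : RealRootedSeq n (fun k => p k * ((-1) ^ k * rising a k)) := by
  have hb : 0 < 1 - a - n := by linarith
  refine (h.mul (realRootedSeq_laguerreCoeff n (1 - a - n) (by linarith)).reverse
    fun k _ => laguerreCoeff_pos hb (by omega)).congr fun k hk => ?_
  have h3 : (n.choose k : ℝ) ≠ 0 := by exact_mod_cast (Nat.choose_pos hk).ne'
  rw [laguerreCoeff, Nat.choose_symm hk, show n - (n - k) = k by omega, neg_one_pow_mul_rising,
    Nat.cast_sub hk, show 1 - a - n + (n - k : ℝ) = 1 - a - k by ring]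
  field_simp

/-! ### Membership in the classes of polynomials -/

theorem rising_neg_div_factorial {n k : ℕ} (hk : k ≤ n) :
    rising (-(n : ℝ)) k / (k.factorial : ℝ) = (-1) ^ k * n.choose k := by
  have h1 := neg_one_pow_mul_rising (-(n : ℝ)) k
  have h2 : rising (1 - -(n : ℝ) - k) k = (k.factorial * n.choose k : ℕ) := by
    rw [← Nat.descFactorial_eq_factorial_mul_choose]
    have := ascPochhammer_nat_eq_natCast_descFactorial ℝ (n + 1 - k) k
    rw [show n + 1 - k + k - 1 = n by omega, Nat.cast_sub (by omega)] at this
    rw [← this, rising]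
    push_cast
    ring_nf
  have h3 : ((-1 : ℝ) ^ k) * (-1) ^ k = 1 := by rw [← mul_pow]; norm_num
  rw [div_eq_iff (by positivity)]
  rw [h2] at h1
  push_cast at h1
  linear_combination (-1) ^ k * h1 - rising (-(n : ℝ)) k * h3

theorem hypergeometricPoly_natDegree_le (n : ℕ) {i j : ℕ} (a : Fin i → ℝ) (b : Fin j → ℝ) :
    (hypergeometricPoly n a b).natDegree ≤ n := by
  refine natDegree_sum_le_of_forall_le _ _ fun k hk => ?_
  refine (natDegree_C_mul_X_pow_le _ _).trans ?_
  simpa [Nat.lt_succ_iff] using hk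

theorem aeval_hypergeometricPoly {n : ℕ} {a₁ a₂ b₁ b₂ : ℝ} (h₁ : rising b₁ n ≠ 0)
    (h₂ : rising b₂ n ≠ 0) (z : ℂ) :
    aeval z (hypergeometricPoly n ![a₁, a₂] ![b₁, b₂]) = ((rising b₁ n * rising b₂ n : ℝ) : ℂ) *
      (seqPoly n (fun k => hyperCoeff n a₁ b₁ b₂ k * ((-1) ^ k * rising a₂ k))).eval z := by
  rw [seqPoly_eval, hypergeometricPoly, map_sum, Finset.mul_sum]
  refine Finset.sum_congr rfl fun k hk => ?_
  have hk : k ≤ n := by simpa [Nat.lt_succ_iff] using hk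
  have e1 := rising_sub_eq_div h₁ hk
  have e2 := rising_sub_eq_div h₂ hk
  have e3 := rising_neg_div_factorial hk
  rw [map_mul, map_pow, aeval_X, aeval_C, ← mul_assoc, ← Complex.ofReal_mul]
  congr 1
  rw [Complex.coe_algebraMap]
  congr 1
  simp only [Fin.prod_univ_two, Matrix.cons_val_zero, Matrix.cons_val_one]
  change rising (-(n : ℝ)) k * (rising a₁ k * rising a₂ k) *
    (rising (b₁ + k) (n - k) * rising (b₂ + k) (n - k)) / k.factorial = _
  rw [mul_assoc, mul_div_right_comm, e3, e1, e2, hyperCoeff]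
  have h1 := rising_sub_ne_zero h₁ hk
  have h2 := rising_sub_ne_zero h₂ hk
  field_simp

theorem RealRootedSeq.mem_realLine {n : ℕ} {a₁ a₂ b₁ b₂ : ℝ}
    (h : RealRootedSeq n (hyperCoeff n a₁ b₁ b₂)) (h₁ : rising b₁ n ≠ 0)
    (h₂ : rising b₂ n ≠ 0) (ha : a₂ < -(n : ℝ) + 1) :
    hypergeometricPoly n ![a₁, a₂] ![b₁, b₂] ∈ polysWithZerosIn n realLine := by
  refine ⟨hypergeometricPoly_natDegree_le n _ _, fun z hz => ?_⟩
  rw [aeval_hypergeometricPoly h₁ h₂] at hz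
  have hz := (mul_eq_zero.1 hz).resolve_left (by exact_mod_cast mul_ne_zero h₁ h₂)
  exact ⟨z.re, Complex.ext rfl (by simpa using ((h.mul_rising ha).im_eq_zero hz).symm)⟩

theorem RealRootedSeq.mem_negRealLine {n : ℕ} {a₁ a₂ b₁ b₂ : ℝ}
    (h : RealRootedSeq n (hyperCoeff n a₁ b₁ b₂)) (h₂ : 0 < b₂)
    (hpos : ∀ k, 0 < rising a₁ k / rising b₁ k) (ha : a₂ < -(n : ℝ) + 1) :
    hypergeometricPoly n ![a₁, a₂] ![b₁, b₂] ∈ polysWithZerosIn n negRealLine := by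
  have h₁ : rising b₁ n ≠ 0 := fun h0 => by simpa [h0] using hpos n
  refine ⟨hypergeometricPoly_natDegree_le n _ _, fun z hz => ?_⟩
  rw [aeval_hypergeometricPoly h₁ (rising_pos h₂ n).ne'] at hz
  have hz := (mul_eq_zero.1 hz).resolve_left
    (by exact_mod_cast mul_ne_zero h₁ (rising_pos h₂ n).ne')
  obtain ⟨h1, h2⟩ := (h.mul_rising ha).neg_root (fun k hk => by
    rw [hyperCoeff, neg_one_pow_mul_rising, ← div_div]
    have hk' : (k : ℝ) ≤ n := by exact_mod_cast hk
    exact mul_pos (mul_pos (by exact_mod_cast Nat.choose_pos hk)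
      (div_pos (hpos k) (rising_pos h₂ k))) (rising_pos (by linarith) k)) hz
  exact ⟨z.re, h2, Complex.ext rfl (by simpa using h1.symm)⟩

/-! ### Signs of the coefficients and assembly of the cases -/

theorem rising_div_pos_of_pos {a b : ℝ} (ha : 0 < a) (hb : 0 < b) (k : ℕ) :
    0 < rising a k / rising b k := div_pos (rising_pos ha k) (rising_pos hb k)

theorem rising_div_pos_of_neg {a b : ℝ} (ha : -1 < a) (ha' : a < 0) (hb : -1 < b) (hb' : b < 0)
    (k : ℕ) : 0 < rising a k / rising b k := by
  cases k with
  | zero => simp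
  | succ k =>
    rw [rising_succ', rising_succ', mul_div_mul_comm]
    exact mul_pos (div_pos_of_neg_of_neg ha' hb')
      (rising_div_pos_of_pos (by linarith) (by linarith) k)

theorem realRootedSeq_hyperCoeff_half {n : ℕ} (k : ℕ) {b₁ b₂ : ℝ} (h₁ : 0 < b₁) (h₂ : -1 < b₂)
    (h₂' : b₂ ≠ 0) (h : b₁ + b₂ = 2 ∨ b₁ + b₂ = 1) :
    RealRootedSeq n (hyperCoeff n (1 / 2 + k) b₁ b₂) := by
  refine RealRootedSeq.hyperCoeff_upper (by norm_num) ?_ k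
  rcases h with h | h
  · exact realRootedSeq_hyperCoeff_add_eq_two n (by linarith) h₁.ne' h₂ h₂' h
  -- Here `(b₁+1) + b₂ = 2`, so the sum-two case applies before lowering `b₁+1` by one.
  · refine (RealRootedSeq.hyperCoeff_lower_nat h₁ 1 ?_).hyperCoeff_swap
    exact realRootedSeq_hyperCoeff_add_eq_two n h₂ h₂' (by push_cast; linarith)
      (by push_cast; linarith) (by push_cast; linarith)

theorem mainTheorem11 (n : ℕ) (hn : 4 ≤ n) :
    (∀ (k : ℕ) (t a₁ a₂ b₁ b₂ : ℝ), k < n →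
      ((∃ m : ℕ, m < n ∧ t = m) ∨ (n : ℝ) - 2 < t) →
      (∀ m : ℕ, m < n → a₁ ≠ -(m : ℝ)) →
      a₂ < -(n : ℝ) + 1 →
      (0 < b₂ →
        ((a₁ = k + 1 / 2 ∧ ((b₁ = 2 - b₂ ∧ 0 < b₁) ∨ (b₁ = 1 - b₂ ∧ 0 < b₁))) ∨
          (a₁ = b₁ + k - 1 / 2 ∧ b₁ = (b₂ + t + 1) / 2) ∨
          (a₁ = (b₁ + 1) / 2 + k ∧ b₁ = 2 * (b₂ - 1 + t) ∧ 0 < b₁) ∨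
          (a₁ = b₁ / 2 + k ∧ b₁ = 2 * (b₂ + t) - 1 ∧ (0 < b₁ ∨ k = 0))) →
        hypergeometricPoly n ![a₁, a₂] ![b₁, b₂] ∈ polysWithZerosIn n negRealLine) ∧
      (((a₁ = b₂ - 1 / 2 ∧ b₁ = 2 * b₂ - 2 ∧ b₂ ∈ Set.Ioo (0 : ℝ) 1) ∨
          (a₁ = b₂ - 1 / 2 ∧ b₁ = 2 * b₂ - 1 ∧ b₂ ∈ Set.Ioo (-1 : ℝ) 0) ∨
          (a₁ = b₂ + k - 1 / 2 ∧ b₁ = 2 * b₂ - 2 ∧ b₂ ∈ Set.Ioo (1 / 2 : ℝ) 1) ∨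
          (a₁ = k + 1 / 2 ∧ (b₁ + b₂ = 1 ∨ b₁ + b₂ = 2) ∧ b₂ ∈ Set.Ioo (-1 : ℝ) 0)) →
        hypergeometricPoly n ![a₁, a₂] ![b₁, b₂] ∈ polysWithZerosIn n realLine)) ∧
    hypergeometricPoly n ![1 / 2, -(n : ℝ) + 1 / 2] ![1, 1] ∈ polysWithZerosIn n negRealLine ∧
    hypergeometricPoly n ![1 / 2, -(n : ℝ) - 1 / 2] ![1, 1] ∈ polysWithZerosIn n negRealLine := by
  have hn4 : (4 : ℝ) ≤ n := by exact_mod_cast hn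
  have hhalf : RealRootedSeq n (hyperCoeff n (1 / 2) 1 1) :=
    realRootedSeq_hyperCoeff_add_eq_two n (by norm_num) one_ne_zero (by norm_num) one_ne_zero
      (by norm_num)
  have hhalf' := rising_div_pos_of_pos (show (0 : ℝ) < 1 / 2 by norm_num) one_pos
  refine ⟨fun k t a₁ a₂ b₁ b₂ hk ht ha₁ ha₂ => ⟨fun hb₂ h => ?_, fun h => ?_⟩,
    hhalf.mem_negRealLine one_pos hhalf' (by linarith),
    hhalf.mem_negRealLine one_pos hhalf' (by linarith)⟩
  · have ht0 : 0 ≤ t := by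
      rcases ht with ⟨m, _, rfl⟩ | ht
      · positivity
      · linarith
    have hk0 : (0 : ℝ) ≤ k := by positivity
    rcases h with ⟨ha, hb⟩ | ⟨ha, hb⟩ | ⟨ha, hb, hb₁⟩ | ⟨ha, hb, hb₁⟩
    · have hb₁ : 0 < b₁ := by rcases hb with hb | hb <;> exact hb.2
      have h := realRootedSeq_hyperCoeff_half (n := n) k hb₁ (show -1 < b₂ by linarith) hb₂.ne'
        (by rcases hb with hb | hb <;> [left; right] <;> linarith [hb.1])
      rw [show 1 / 2 + (k : ℝ) = a₁ by linarith] at h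
      exact h.mem_negRealLine hb₂ (rising_div_pos_of_pos (by linarith) hb₁) ha₂
    · have hb₁ : 1 / 2 < b₁ := by linarith
      have h := realRootedSeq_hyperCoeff_two_mul_sub_one n (show -1 < b₁ by linarith)
        (by linarith) (rising_pos (show 0 < 2 * b₁ - 1 by linarith) n).ne'
      rw [show 2 * b₁ - 1 = b₂ + t by linarith] at h
      have h := (h.hyperCoeff_lower (by omega) hb₂ ht).hyperCoeff_upper (by linarith) k
      rw [show b₁ - 1 / 2 + k = a₁ by linarith] at h
      exact h.mem_negRealLine hb₂ (rising_div_pos_of_pos (by linarith) (by linarith)) ha₂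
    · have h := realRootedSeq_hyperCoeff_two_mul_sub_two n (show 0 < b₂ + t by linarith)
        (by intro h0; linarith) (rising_pos (show 0 < 2 * (b₂ + t) - 2 by linarith) n).ne'
      rw [show 2 * (b₂ + t) - 2 = b₁ by linarith] at h
      have h := (h.hyperCoeff_swap.hyperCoeff_lower (by omega) hb₂ ht).hyperCoeff_upper
        (by linarith) k
      rw [show b₂ + t - 1 / 2 + k = a₁ by linarith] at h
      exact h.mem_negRealLine hb₂ (rising_div_pos_of_pos (by linarith) hb₁) ha₂
    · have hb₁0 : b₁ ≠ 0 := by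
        rcases hb₁ with hb₁ | rfl
        · exact hb₁.ne'
        · rintro rfl
          exact ha₁ 0 (by omega) (by rw [ha]; simp)
      have hb₁' : -1 < b₁ := by linarith
      have hbt : 2 * (b₂ + t) - 1 = b₁ := hb.symm
      have h := realRootedSeq_hyperCoeff_two_mul_sub_one n (show -1 < b₂ + t by linarith)
        (by linarith) (by rw [hbt]; exact rising_ne_zero_of_neg_one_lt hb₁' hb₁0 n)
      rw [hbt] at h
      have h := h.hyperCoeff_swap.hyperCoeff_lower (by omega) hb₂ ht
      rw [show b₂ + t - 1 / 2 = b₁ / 2 by linarith] at h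
      rcases lt_or_gt_of_ne hb₁0 with hneg | hpos
      -- Both `b₁` and `a₁ = b₁/2` lie in `(-1,0)`, so their rising factorials share a sign and the
      -- coefficients stay positive.
      · obtain rfl : k = 0 := hb₁.resolve_left hneg.not_gt
        rw [show b₁ / 2 = a₁ by rw [ha]; simp] at h
        have ha' : a₁ = b₁ / 2 := by rw [ha]; simp
        exact h.mem_negRealLine hb₂
          (rising_div_pos_of_neg (by linarith) (by linarith) hb₁' hneg) ha₂
      · have h := h.hyperCoeff_upper (by linarith) k
        rw [← ha] at h
        exact h.mem_negRealLine hb₂ (rising_div_pos_of_pos (by linarith) hpos) ha₂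
  · have h0 := ha₁ 0 (by omega)
    have h1 := ha₁ 1 (by omega)
    push_cast at h0 h1
    rcases h with ⟨ha, hb, hb0, hb1⟩ | ⟨ha, hb, hb0, hb1⟩ | ⟨ha, hb, hb0, hb1⟩ | ⟨ha, hb, hb0, hb1⟩
    -- As `b₁ ∈ (-2,0)`, only `b₁ = -1` could fail; it means `a₁ = 0`, which is excluded.
    · have hr : rising b₁ n ≠ 0 := by
        refine rising_ne_zero fun m _ hm => ?_
        have h3 : (m : ℝ) < 2 := by linarith
        have h4 : m < 2 := by exact_mod_cast h3
        interval_cases m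
        · norm_num at hm; linarith
        · norm_num at hm; exact h0 (by linarith)
      have h := realRootedSeq_hyperCoeff_two_mul_sub_two n hb0 hb1.ne (by rwa [← hb])
      rw [← ha, ← hb] at h
      exact h.hyperCoeff_swap.mem_realLine hr (rising_pos hb0 n).ne' ha₂
    -- As `b₁ ∈ (-3,-1)`, only `b₁ = -2` could fail; it means `a₁ = -1`, which is excluded.
    · have hr : rising b₁ n ≠ 0 := by
        refine rising_ne_zero fun m _ hm => ?_
        have h3 : (m : ℝ) < 3 := by linarith
        have h3' : (1 : ℝ) < m := by linarith
        have h4 : m < 3 := by exact_mod_cast h3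
        have h4' : 1 < m := by exact_mod_cast h3'
        obtain rfl : m = 2 := by omega
        norm_num at hm
        exact h1 (by linarith)
      have h := realRootedSeq_hyperCoeff_two_mul_sub_one n hb0 hb1.ne (by rwa [← hb])
      rw [← ha, ← hb] at h
      exact h.hyperCoeff_swap.mem_realLine hr (rising_ne_zero_of_neg_one_lt hb0 hb1.ne n) ha₂
    · have hb₂ : 0 < b₂ := by linarith
      have hr : rising b₁ n ≠ 0 :=
        rising_ne_zero_of_neg_one_lt (by linarith) (by intro h0; linarith) n
      have h := (realRootedSeq_hyperCoeff_two_mul_sub_two n hb₂ hb1.ne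
        (by rwa [← hb])).hyperCoeff_upper (by linarith) k
      rw [← hb, show b₂ - 1 / 2 + k = a₁ by linarith] at h
      exact h.hyperCoeff_swap.mem_realLine hr (rising_pos hb₂ n).ne' ha₂
    · have hb₁ : 0 < b₁ := by rcases hb with hb | hb <;> linarith
      have h := realRootedSeq_hyperCoeff_half (n := n) k hb₁ hb0 hb1.ne hb.symm
      rw [show 1 / 2 + (k : ℝ) = a₁ by linarith] at h
      exact h.mem_realLine (rising_pos hb₁ n).ne' (rising_ne_zero_of_neg_one_lt hb0 hb1.ne n) ha₂
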